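/- Let $M,n$ be natural numbers. A source evolves as an irreducible continuous-time Markov chain $Q(t)$ on $\{1,\dots,M\}$ with generator matrix $(q_{ij})$ and stationary distribution $\pi$. Each node $i$ of a fully connected network of $n$ nodes stores a packet with content $S_i(t)\in\{1,\dots,M\}$ and version age $X_i(t)\in\{0,1,2,\dots\}$. Let $\lambda,\lambda_s>0$. The triple $(Q,S,X)$ is the continuous-time Markov chain with the following transitions: - the source moves from its state $i$ to $j\ne i$ at rate $q_{ij}$; then every version age increases by $1$ and no content changes; - for each node $j$, at rate $\lambda_s/n$ the source pushes its state to $j$: $S_j:=Q$ and $X_j:=0$; - for each ordered pair of nodes $i\neq j$, at rate $\lambda/(n-1)$ node $i$ sends its packet to node $j$, which accepts it if and only if it is fresher: if $X_i<X_j$ then $S_j:=S_i$ and $X_j:=X_i$; otherwise nothing changes. For a set $A$ of nodes with $|A|=k$ and a state $q$, let $N_A^{(q)}(t)=\#\{j\in A: S_j(t)=q\}$ be the number of nodes of $A$ that hold content $q$. Then, for all $\lambda,\lambda_s>0$, all such $A$ and all $q$: 1. for every initial law of $(Q,S,X)$, $$\lim_{t\to\infty}\mathbb{E}\big[N_A^{(q)}(t)\big]=k\,\pi_q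 ;$$ 2. under every invariant probability law of $(Q,S,X)$, the expected number of nodes of $A$ that hold content $q$ equals $k\,\pi_q$. In particular the steady-state value depends neither on $\lambda$ nor on $\lambda_s$. -/

import Mathlib

open MeasureTheory Filter Topology
open scoped BoundedContinuousFunction NNReal

/-- `R` is the generator matrix of an irreducible continuous-time Markov chain on `Fin M`:
`R i j` (for `i ≠ j`) is the rate of the transition from `i` to `j`. -/
structure IsIrreducibleGenerator {M : ℕ} (R : Matrix (Fin M) (Fin M) ℝ) : Prop where
  offDiag_nonneg : ∀ i j, i ≠ j → 0 ≤ R i j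
  row_sum : ∀ i, ∑ j, R i j = 0
  irreducible : ∀ i j, Relation.ReflTransGen (fun a b => a ≠ b ∧ 0 < R a b) i j

/-- `π` is a stationary distribution of the chain with generator matrix `R`. -/
structure IsStationaryDistribution {M : ℕ} (R : Matrix (Fin M) (Fin M) ℝ)
    (π : Fin M → ℝ) : Prop where
  nonneg : ∀ i, 0 ≤ π i
  sum_eq_one : ∑ i, π i = 1
  balance : Matrix.vecMul π R = 0

/-- A configuration of the network: the state `Q` of the source, and for every node `i` the
content `S i` of the packet that it stores and the version age `X i` of that packet. -/
@[ext]
structure GossipState (M n : ℕ) where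
  source : Fin M
  content : Fin n → Fin M
  age : Fin n → ℕ

namespace GossipState

variable {M n : ℕ}

/-- The (countable) set of configurations is discrete. -/
instance : TopologicalSpace (GossipState M n) := ⊥

instance : DiscreteTopology (GossipState M n) := ⟨rfl⟩

instance : MeasurableSpace (GossipState M n) := ⊤

/-- The source moves to state `m`: a new version is generated, so all version ages grow by one. -/
def jump (x : GossipState M n) (m : Fin M) : GossipState M n where
  source := m
  content := x.content
  age := fun l => x.age l + 1

/-- The source pushes its current state to node `j`. -/
def push (x : GossipState M n) (j : Fin n) : GossipState M n where
  source := x.source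
  content := Function.update x.content j x.source
  age := Function.update x.age j 0

/-- Node `i` sends its packet to node `j`, which accepts it if and only if it is fresher than
its own packet. -/
def gossip (x : GossipState M n) (i j : Fin n) : GossipState M n where
  source := x.source
  content := Function.update x.content j
    (if x.age i < x.age j then x.content i else x.content j)
  age := Function.update x.age j (min (x.age i) (x.age j))

/-- The number of nodes of `A` that hold content `q`. -/
def numHolding (A : Finset (Fin n)) (q : Fin M) (x : GossipState M n) : ℕ :=
  (A.filter (fun j => x.content j = q)).card

end GossipState

/-- The operator `exp (t L)` for a bounded operator `L`. -/
noncomputable def expOperator {E : Type*} [NormedAddCommGroup E] [NormedSpace ℝ E]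
    (L : E →L[ℝ] E) (t : ℝ≥0) : E →L[ℝ] E :=
  NormedSpace.exp ((t : ℝ) • L)

section Generator

variable {M n : ℕ}

/-- The infinitesimal generator as a formula: the sum over all transitions (source transitions,
pushes at rate `lams / n` to each node, gossip at rate `lam / (n - 1)` for each ordered pair of
distinct nodes) of the rate times the increment of `f`. -/
noncomputable def gossipGeneratorFun (R : Matrix (Fin M) (Fin M) ℝ) (lams lam : ℝ)
    (f : GossipState M n → ℝ) (x : GossipState M n) : ℝ :=
  (∑ m ∈ Finset.univ.erase x.source, R x.source m * (f (x.jump m) - f x))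
    + (∑ j : Fin n, lams / (n : ℝ) * (f (x.push j) - f x))
    + ∑ i : Fin n, ∑ j ∈ Finset.univ.erase i,
        lam / ((n : ℝ) - 1) * (f (x.gossip i j) - f x)

/-- A bound for the norm of the generator (twice a bound for the total jump rate). -/
noncomputable def gossipRateBound (n : ℕ) (R : Matrix (Fin M) (Fin M) ℝ) (lams lam : ℝ) : ℝ :=
  (∑ i, ∑ m, |R i m| * 2) + (∑ _j : Fin n, |lams / (n : ℝ)| * 2)
    + ∑ _i : Fin n, ∑ _j : Fin n, |lam / ((n : ℝ) - 1)| * 2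

theorem abs_gossipGeneratorFun_le (R : Matrix (Fin M) (Fin M) ℝ) (lams lam : ℝ)
    (f : GossipState M n →ᵇ ℝ) (x : GossipState M n) :
    |gossipGeneratorFun R lams lam f x| ≤ gossipRateBound n R lams lam * ‖f‖ := by
  have key : ∀ (c : ℝ) (y : GossipState M n), |c * (f y - f x)| ≤ |c| * 2 * ‖f‖ := by
    intro c y
    rw [abs_mul, mul_assoc]
    refine mul_le_mul_of_nonneg_left ?_ (abs_nonneg c)
    have h1 := f.norm_coe_le_norm y
    have h2 := f.norm_coe_le_norm x
    rw [Real.norm_eq_abs] at h1 h2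
    have h3 := abs_sub (f y) (f x)
    linarith
  have nn : ∀ c : ℝ, 0 ≤ |c| * 2 * ‖f‖ := fun c => by positivity
  unfold gossipGeneratorFun gossipRateBound
  rw [add_mul, add_mul]
  refine (abs_add_le _ _).trans (add_le_add ((abs_add_le _ _).trans (add_le_add ?_ ?_)) ?_)
  · refine (Finset.abs_sum_le_sum_abs _ _).trans ?_
    refine (Finset.sum_le_sum fun m _ => key (R x.source m) (x.jump m)).trans ?_
    rw [Finset.sum_mul]
    refine le_trans ?_ (Finset.single_le_sum (f := fun i => (∑ m, |R i m| * 2) * ‖f‖)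
      (fun i _ => by positivity) (Finset.mem_univ x.source))
    rw [Finset.sum_mul]
    exact Finset.sum_le_sum_of_subset_of_nonneg (Finset.erase_subset _ _) fun m _ _ => nn _
  · refine (Finset.abs_sum_le_sum_abs _ _).trans ?_
    rw [Finset.sum_mul]
    exact Finset.sum_le_sum fun j _ => key _ _
  · refine (Finset.abs_sum_le_sum_abs _ _).trans ?_
    rw [Finset.sum_mul]
    refine Finset.sum_le_sum fun i _ => (Finset.abs_sum_le_sum_abs _ _).trans ?_
    refine (Finset.sum_le_sum fun j _ => key _ (x.gossip i j)).trans ?_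
    rw [Finset.sum_mul]
    exact Finset.sum_le_sum_of_subset_of_nonneg (Finset.erase_subset _ _) fun m _ _ => nn _

theorem gossipRateBound_nonneg (n : ℕ) (R : Matrix (Fin M) (Fin M) ℝ) (lams lam : ℝ) :
    0 ≤ gossipRateBound n R lams lam := by
  unfold gossipRateBound
  positivity

/-- The infinitesimal generator as a bounded operator on the bounded functions. -/
noncomputable def gossipGenerator (n : ℕ) (R : Matrix (Fin M) (Fin M) ℝ) (lams lam : ℝ) :
    (GossipState M n →ᵇ ℝ) →L[ℝ] (GossipState M n →ᵇ ℝ) :=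
  LinearMap.mkContinuous
    { toFun := fun f => BoundedContinuousFunction.ofNormedAddCommGroupDiscrete
        (gossipGeneratorFun R lams lam f) (gossipRateBound n R lams lam * ‖f‖)
        (abs_gossipGeneratorFun_le R lams lam f)
      map_add' := by
        intro f g
        ext x
        simp only [BoundedContinuousFunction.coe_ofNormedAddCommGroupDiscrete,
          BoundedContinuousFunction.coe_add, Pi.add_apply, gossipGeneratorFun,
          add_sub_add_comm, mul_add, Finset.sum_add_distrib]
        ring
      map_smul' := by
        intro c f
        ext x
        simp only [BoundedContinuousFunction.coe_ofNormedAddCommGroupDiscrete,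
          BoundedContinuousFunction.coe_smul, gossipGeneratorFun, smul_eq_mul,
          RingHom.id_apply, mul_add, Finset.mul_sum, ← mul_sub, mul_left_comm c] }
    (gossipRateBound n R lams lam)
    (fun f => BoundedContinuousFunction.norm_ofNormedAddCommGroup_le _
      (mul_nonneg (gossipRateBound_nonneg n R lams lam) (norm_nonneg f))
      (abs_gossipGeneratorFun_le R lams lam f))

/-- The transition semigroup `exp (t L)` of the network, `L` being its generator:
`(gossipSemigroup n R lams lam t f) x` is the mean of `f` at time `t` when starting from `x`. -/
noncomputable def gossipSemigroup (n : ℕ) (R : Matrix (Fin M) (Fin M) ℝ) (lams lam : ℝ)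
    (t : ℝ≥0) : (GossipState M n →ᵇ ℝ) →L[ℝ] (GossipState M n →ᵇ ℝ) :=
  expOperator (gossipGenerator n R lams lam) t

/-- `Y` is (a version of) the continuous-time Markov chain of the network: a Markov process, for
its own history, with transition semigroup `gossipSemigroup`. Its initial law is arbitrary. -/
structure IsGossipProcess {Ω : Type*} [MeasurableSpace Ω] (P : Measure Ω)
    (R : Matrix (Fin M) (Fin M) ℝ) (lams lam : ℝ) (Y : ℝ≥0 → Ω → GossipState M n) : Prop where
  measurable : ∀ t, Measurable (Y t)
  markov : ∀ (s t : ℝ≥0) (f : GossipState M n →ᵇ ℝ),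
    P[fun ω => f (Y (s + t) ω) | ⨆ r : Set.Iic s, MeasurableSpace.comap (Y r) inferInstance]
      =ᵐ[P] fun ω => gossipSemigroup n R lams lam t f (Y s ω)

/-- `μ` is a steady-state (invariant) law of the network. -/
def IsSteadyStateLaw (R : Matrix (Fin M) (Fin M) ℝ) (lams lam : ℝ)
    (μ : Measure (GossipState M n)) : Prop :=
  ∀ (t : ℝ≥0) (f : GossipState M n →ᵇ ℝ),
    ∫ x, gossipSemigroup n R lams lam t f x ∂μ = ∫ x, f x ∂μ

end Generator

/-! ### Differential inequalities -/

/-! The proof is a duality argument. For a nonempty set `B` of nodes, let `h B` be the indicator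
that a freshest packet in `B` has content `q`. Source moves raise all ages together and leave `h B`
alone. A push into `B` replaces `h B` by the indicator of `Q = q`. Gossip from `i` into `B` replaces
it by `h (insert i B)`. Hence the mean of `h B` solves `y' = F - κ y`, where `F` involves only the
source and strictly larger sets. The source is an autonomous irreducible chain, so its law tends to
`π`. Induction from large sets to small ones then gives the limit `π q` for every nonempty `B`,
whatever the rates, and `B = {j}` is the content of node `j`.

These replacement rules need consistent states: equal ages carry equal contents, and age `0` carries
the source state. The initial law may charge inconsistent states. Consistency is preserved by every
transition, and a Lyapunov function shows that the mass of inconsistent states decays exponentially,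
so the error in the equation vanishes (`exists_lyapunov`, `tendsto_gossipMean_zero`).

The jump rates are bounded, so the semigroup is `exp (t L)` with `L` bounded and means may be
differentiated freely. Dominated convergence passes from fixed initial states to initial laws. An
invariant law makes the integral constant in time, hence equal to its limit. -/

theorem eventually_le_add_of_deriv_le {y y' : ℝ → ℝ} {κ c T : ℝ} (hκ : 0 < κ)
    (hy : ∀ t, HasDerivAt y (y' t) t) (hle : ∀ t, T ≤ t → y' t ≤ κ * (c - y t))
    {ε : ℝ} (hε : 0 < ε) : ∀ᶠ t in atTop, y t ≤ c + ε := by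
  -- Integrating factor: `exp (κ t) (y - c)` is nonincreasing from time `T` on.
  have hz : ∀ t, HasDerivAt (fun t => Real.exp (κ * t) * (y t - c))
      (Real.exp (κ * t) * (y' t - κ * (c - y t))) t := by
    intro t
    have h1 : HasDerivAt (fun t : ℝ => Real.exp (κ * t)) (Real.exp (κ * t) * (κ * 1)) t :=
      ((hasDerivAt_id t).const_mul κ).exp
    exact (h1.mul ((hy t).sub_const c)).congr_deriv (by ring)
  have hanti : AntitoneOn (fun t => Real.exp (κ * t) * (y t - c)) (Set.Ici T) := by
    refine antitoneOn_of_deriv_nonpos (convex_Ici T)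
      (fun t _ => (hz t).continuousAt.continuousWithinAt)
      (fun t _ => (hz t).differentiableAt.differentiableWithinAt) fun t ht => ?_
    rw [interior_Ici] at ht
    rw [(hz t).deriv]
    exact mul_nonpos_of_nonneg_of_nonpos (Real.exp_pos _).le (by linarith [hle t (le_of_lt ht)])
  have hlim : Tendsto (fun t : ℝ => ε * Real.exp (κ * t)) atTop atTop :=
    (Real.tendsto_exp_atTop.comp (tendsto_id.const_mul_atTop hκ)).const_mul_atTop hε
  filter_upwards [hlim.eventually_ge_atTop (Real.exp (κ * T) * (y T - c)),
    eventually_ge_atTop T] with t h1 h2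
  have h3 := hanti (Set.mem_Ici.2 le_rfl) (Set.mem_Ici.2 h2) h2
  have h4 : Real.exp (κ * t) * (y t - c) ≤ Real.exp (κ * t) * ε := by
    simp only at h3
    linarith
  linarith [le_of_mul_le_mul_left h4 (Real.exp_pos _)]

theorem tendsto_zero_of_deriv_le {y y' : ℝ → ℝ} {κ : ℝ} (hκ : 0 < κ)
    (hy : ∀ t, HasDerivAt y (y' t) t) (hnn : ∀ t, 0 ≤ t → 0 ≤ y t)
    (hle : ∀ t, 0 ≤ t → y' t ≤ -κ * y t) : Tendsto y atTop (𝓝 0) := by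
  rw [tendsto_order]
  refine ⟨fun a ha => ?_, fun a ha => ?_⟩
  · filter_upwards [eventually_ge_atTop 0] with t ht using ha.trans_le (hnn t ht)
  · filter_upwards [eventually_le_add_of_deriv_le (c := 0) (T := 0) hκ hy
      (fun t ht => by linarith [hle t ht]) (half_pos ha)] with t ht
    linarith

/-- Once `F` is within `κ ε / 4` of `κ c`, the one-sided estimate applies to both `y` and `-y`. -/
theorem tendsto_of_hasDerivAt_relaxation {y F : ℝ → ℝ} {κ c : ℝ} (hκ : 0 < κ)
    (hy : ∀ t, HasDerivAt y (F t - κ * y t) t) (hF : Tendsto F atTop (𝓝 (κ * c))) :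
    Tendsto y atTop (𝓝 c) := by
  rw [Metric.tendsto_atTop] at hF
  rw [Metric.tendsto_nhds]
  intro ε hε
  obtain ⟨T, hT⟩ := hF (κ * (ε / 4)) (by positivity)
  have hT' : ∀ t, T ≤ t → |F t - κ * c| < κ * (ε / 4) := hT
  filter_upwards [eventually_le_add_of_deriv_le (c := c + ε / 4) (T := T) hκ hy
      (fun t ht => by linarith [(abs_lt.1 (hT' t ht)).2]) (ε := ε / 4) (by positivity),
    eventually_le_add_of_deriv_le (c := -c + ε / 4) (T := T) hκ (fun t => (hy t).neg)
      (fun t ht => by simp only [Pi.neg_apply]; linarith [(abs_lt.1 (hT' t ht)).1]) (ε := ε / 4) (by positivity)]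
    with t h1 h2
  rw [Real.dist_eq, abs_lt]
  simp only [Pi.neg_apply] at h2
  constructor <;> linarith

/-! ### Convergence to equilibrium of a finite irreducible chain -/

section FiniteChain

variable {M : ℕ} {R : Matrix (Fin M) (Fin M) ℝ} {π : Fin M → ℝ}

theorem IsStationaryDistribution.sum_mul_eq_zero (hπ : IsStationaryDistribution R π)
    (j : Fin M) : ∑ i, π i * R i j = 0 := by
  have := congrFun hπ.balance j
  simpa [Matrix.vecMul, dotProduct] using this

theorem IsStationaryDistribution.pos (hπ : IsStationaryDistribution R π)
    (hR : IsIrreducibleGenerator R) (i : Fin M) : 0 < π i := by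
  refine lt_of_le_of_ne (hπ.nonneg i) fun h0 => ?_
  -- If `π b = 0`, the diagonal term of the balance equation at `b` vanishes and the others are
  -- nonnegative, so all are zero: zeros of `π` propagate backwards along edges.
  have hstep : ∀ a b, a ≠ b ∧ 0 < R a b → π b = 0 → π a = 0 := by
    intro a b hab hb
    have hnn : ∀ k ∈ Finset.univ, 0 ≤ π k * R k b := by
      intro k _
      by_cases hk : k = b
      · simp [hk, hb]
      · exact mul_nonneg (hπ.nonneg k) (hR.offDiag_nonneg k b hk)
    have := (Finset.sum_eq_zero_iff_of_nonneg hnn).1 (hπ.sum_mul_eq_zero b) a (Finset.mem_univ a)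
    exact (mul_eq_zero.1 this).resolve_right hab.2.ne'
  have hall : ∀ j, π j = 0 := by
    intro j
    induction hR.irreducible j i using Relation.ReflTransGen.head_induction_on with
    | refl => exact h0.symm
    | head hab _ ih => exact hstep _ _ hab ih
  simpa [hall] using hπ.sum_eq_one

/-- The Dirichlet form of a chain with generator `R` and stationary distribution `π`. -/
def dirichletForm (R : Matrix (Fin M) (Fin M) ℝ) (π u : Fin M → ℝ) : ℝ :=
  ∑ i, ∑ j, π i * R i j * (u j - u i) ^ 2

theorem dirichletForm_term_nonneg (hR : IsIrreducibleGenerator R)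
    (hπ : IsStationaryDistribution R π) (u : Fin M → ℝ) (i j : Fin M) :
    0 ≤ π i * R i j * (u j - u i) ^ 2 := by
  by_cases h : i = j
  · simp [h]
  · exact mul_nonneg (mul_nonneg (hπ.nonneg i) (hR.offDiag_nonneg i j h)) (sq_nonneg _)

theorem dirichletForm_nonneg (hR : IsIrreducibleGenerator R)
    (hπ : IsStationaryDistribution R π) (u : Fin M → ℝ) : 0 ≤ dirichletForm R π u :=
  Finset.sum_nonneg fun i _ => Finset.sum_nonneg fun j _ => dirichletForm_term_nonneg hR hπ u i j

/-- Each edge of positive rate is one term of the Dirichlet form with positive weight; a path from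
`i` to `j` chains these bounds. -/
theorem exists_sq_sub_le_dirichletForm (hR : IsIrreducibleGenerator R)
    (hπ : IsStationaryDistribution R π) (i j : Fin M) :
    ∃ c, 0 ≤ c ∧ ∀ u, (u j - u i) ^ 2 ≤ c * dirichletForm R π u := by
  induction hR.irreducible i j with
  | refl => exact ⟨0, le_rfl, fun u => by simp⟩
  | @tail a b _ hab ih =>
    obtain ⟨c, hc, h⟩ := ih
    have hp : 0 < π a * R a b := mul_pos (hπ.pos hR a) hab.2
    -- From `(x + y)² ≤ 2 x² + 2 y²` applied to the path up to `a` and the last edge.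
    refine ⟨2 * c + 2 * (π a * R a b)⁻¹, by positivity, fun u => ?_⟩
    have h1 : π a * R a b * (u b - u a) ^ 2 ≤ dirichletForm R π u :=
      (Finset.single_le_sum (f := fun j => π a * R a j * (u j - u a) ^ 2)
        (fun j _ => dirichletForm_term_nonneg hR hπ u a j) (Finset.mem_univ b)).trans
      (Finset.single_le_sum (f := fun i => ∑ j, π i * R i j * (u j - u i) ^ 2)
        (fun i _ => Finset.sum_nonneg fun j _ => dirichletForm_term_nonneg hR hπ u i j)
        (Finset.mem_univ a))
    have h2 : (u b - u a) ^ 2 ≤ (π a * R a b)⁻¹ * dirichletForm R π u := by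
      rwa [← div_eq_inv_mul, le_div_iff₀' hp]
    nlinarith [h u, sq_nonneg ((u b - u a) - (u a - u i))]

theorem exists_poincare (hR : IsIrreducibleGenerator R) (hπ : IsStationaryDistribution R π) :
    ∃ c, 0 < c ∧ ∀ u : Fin M → ℝ, ∑ i, π i * u i = 0 →
      ∑ i, π i * u i ^ 2 ≤ c * dirichletForm R π u := by
  choose c hc h using exists_sq_sub_le_dirichletForm hR hπ
  refine ⟨(∑ i, ∑ j, c i j) + 1,
    add_pos_of_nonneg_of_pos (Finset.sum_nonneg fun i _ => Finset.sum_nonneg fun j _ => hc i j)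
      one_pos, fun u hu => ?_⟩
  have hE := dirichletForm_nonneg hR hπ u
  have h0 : ∀ i j, (u j - u i) ^ 2 ≤ ((∑ i, ∑ j, c i j) + 1) * dirichletForm R π u := by
    intro i j
    refine (h i j u).trans (mul_le_mul_of_nonneg_right ?_ hE)
    have h1 : c i j ≤ ∑ j, c i j :=
      Finset.single_le_sum (f := fun j => c i j) (fun j _ => hc i j) (Finset.mem_univ j)
    have h2 : ∑ j, c i j ≤ ∑ i, ∑ j, c i j :=
      Finset.single_le_sum (f := fun i => ∑ j, c i j)
        (fun i _ => Finset.sum_nonneg fun j _ => hc i j) (Finset.mem_univ i)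
    linarith
  have h3 : ∀ i, u i ^ 2 ≤ ((∑ i, ∑ j, c i j) + 1) * dirichletForm R π u := by
    intro i
    -- The cross term vanishes because `u` has mean zero under `π`.
    have h4 : ∑ j, π j * (u j - u i) ^ 2 = ∑ j, π j * u j ^ 2 + u i ^ 2 := by
      have : ∀ j, π j * (u j - u i) ^ 2
          = π j * u j ^ 2 - 2 * u i * (π j * u j) + π j * u i ^ 2 := fun j => by ring
      simp only [this, Finset.sum_add_distrib, Finset.sum_sub_distrib, ← Finset.mul_sum,
        ← Finset.sum_mul, hu, hπ.sum_eq_one]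
      ring
    have h5 : ∑ j, π j * (u j - u i) ^ 2
        ≤ ∑ j, π j * (((∑ i, ∑ j, c i j) + 1) * dirichletForm R π u) :=
      Finset.sum_le_sum fun j _ => mul_le_mul_of_nonneg_left (h0 i j) (hπ.nonneg j)
    rw [← Finset.sum_mul, hπ.sum_eq_one, one_mul, h4] at h5
    have h6 : 0 ≤ ∑ j, π j * u j ^ 2 :=
      Finset.sum_nonneg fun j _ => mul_nonneg (hπ.nonneg j) (sq_nonneg _)
    linarith
  calc ∑ i, π i * u i ^ 2
      ≤ ∑ i, π i * (((∑ i, ∑ j, c i j) + 1) * dirichletForm R π u) :=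
        Finset.sum_le_sum fun i _ => mul_le_mul_of_nonneg_left (h3 i) (hπ.nonneg i)
    _ = _ := by rw [← Finset.sum_mul, hπ.sum_eq_one, one_mul]

/-- Expand the square: the `u j ^ 2` terms cancel by stationarity and the `u i ^ 2` terms by zero
row sums. Reversibility plays no role. -/
theorem sum_mul_generator_eq_neg_dirichletForm (hR : IsIrreducibleGenerator R)
    (hπ : IsStationaryDistribution R π) (u : Fin M → ℝ) :
    2 * ∑ j, u j * ∑ i, π i * u i * R i j = -dirichletForm R π u := by
  have h1 : ∀ i j, π i * R i j * (u j - u i) ^ 2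
      = u j ^ 2 * (π i * R i j) - 2 * (u j * (π i * u i * R i j))
        + π i * u i ^ 2 * R i j := fun i j => by ring
  have h2 : ∑ i, ∑ j, u j ^ 2 * (π i * R i j) = 0 := by
    rw [Finset.sum_comm]
    simp only [← Finset.mul_sum, hπ.sum_mul_eq_zero, mul_zero, Finset.sum_const_zero]
  have h3 : ∑ i, ∑ j, π i * u i ^ 2 * R i j = 0 := by
    simp only [← Finset.mul_sum, hR.row_sum, mul_zero, Finset.sum_const_zero]
  unfold dirichletForm
  simp only [h1, Finset.sum_add_distrib, Finset.sum_sub_distrib, h2, h3]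
  rw [Finset.sum_comm]
  simp only [Finset.mul_sum]
  ring

theorem tendsto_stationary_of_hasDerivAt (hR : IsIrreducibleGenerator R)
    (hπ : IsStationaryDistribution R π) {b : ℝ → Fin M → ℝ}
    (hb : ∀ j t, HasDerivAt (fun t => b t j) (∑ i, b t i * R i j) t)
    (hb0 : ∑ i, b 0 i = 1) (j : Fin M) : Tendsto (fun t => b t j) atTop (𝓝 (π j)) := by
  have hpos := hπ.pos hR
  have hsum : ∀ t, ∑ i, b t i = 1 := by
    have hd : ∀ t, HasDerivAt (fun t => ∑ j, b t j) 0 t := by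
      intro t
      refine (HasDerivAt.fun_sum (fun j (_ : j ∈ Finset.univ) => hb j t)).congr_deriv ?_
      rw [Finset.sum_comm]
      simp only [← Finset.mul_sum, hR.row_sum, mul_zero, Finset.sum_const_zero]
    intro t
    rw [← hb0]
    exact is_const_of_deriv_eq_zero (fun t => (hd t).differentiableAt) (fun t => (hd t).deriv) t 0
  -- Relative density minus one. Its variance under `π` has derivative minus the Dirichlet form, so
  -- the Poincaré inequality gives exponential decay.
  set u : ℝ → Fin M → ℝ := fun t i => (b t i - π i) / π i with hu
  have hπu : ∀ t i, π i * u t i = b t i - π i := fun t i => mul_div_cancel₀ _ (hpos i).ne'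
  have hmean : ∀ t, ∑ i, π i * u t i = 0 := by
    intro t
    simp only [hπu, Finset.sum_sub_distrib, hsum, hπ.sum_eq_one, sub_self]
  have hdu : ∀ i t, HasDerivAt (fun t => u t i) ((∑ k, π k * u t k * R k i) / π i) t := by
    intro i t
    refine (((hb i t).sub_const (π i)).div_const (π i)).congr_deriv ?_
    simp only [hπu, sub_mul, Finset.sum_sub_distrib, hπ.sum_mul_eq_zero, sub_zero]
  have hV : ∀ t, HasDerivAt (fun t => ∑ i, π i * u t i ^ 2) (-dirichletForm R π (u t)) t := by
    intro t
    rw [← sum_mul_generator_eq_neg_dirichletForm hR hπ, Finset.mul_sum]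
    refine (HasDerivAt.fun_sum
      (fun i (_ : i ∈ Finset.univ) => ((hdu i t).fun_pow 2).const_mul (π i))).congr_deriv ?_
    refine Finset.sum_congr rfl fun i _ => ?_
    have := (hpos i).ne'
    field_simp
    ring
  obtain ⟨c, hc, hP⟩ := exists_poincare hR hπ
  have hVlim := tendsto_zero_of_deriv_le (inv_pos.2 hc) hV
    (fun t _ => Finset.sum_nonneg fun i _ => mul_nonneg (hpos i).le (sq_nonneg _))
    (fun t _ => by
      rw [neg_mul, neg_le_neg_iff, inv_mul_le_iff₀ hc]
      exact hP _ (hmean t))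
  have hu0 : Tendsto (fun t => π j * u t j ^ 2) atTop (𝓝 0) :=
    squeeze_zero (fun t => mul_nonneg (hpos j).le (sq_nonneg _))
      (fun t => Finset.single_le_sum (f := fun i => π i * u t i ^ 2)
        (fun i _ => mul_nonneg (hpos i).le (sq_nonneg _)) (Finset.mem_univ j)) hVlim
  have hu1 : Tendsto (fun t => (b t j - π j) ^ 2) atTop (𝓝 0) := by
    have := hu0.const_mul (π j)
    rw [mul_zero] at this
    refine this.congr fun t => ?_
    rw [← hπu]
    ring
  have hu2 : Tendsto (fun t => b t j - π j) atTop (𝓝 0) := by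
    have := (Real.continuous_sqrt.tendsto 0).comp hu1
    simp only [Real.sqrt_zero, Function.comp_def, Real.sqrt_sq_eq_abs] at this
    exact (tendsto_zero_iff_abs_tendsto_zero _).2 this
  simpa using hu2.add_const (π j)

end FiniteChain

/-! ### The transition semigroup -/

section ExpFlow

variable {E : Type*} [NormedAddCommGroup E] [NormedSpace ℝ E]

/-- The operator `exp (t L)` for a bounded operator `L` and a real number `t`. -/
noncomputable def expFlow (L : E →L[ℝ] E) (t : ℝ) : E →L[ℝ] E :=
  NormedSpace.exp (t • L)

theorem expFlow_zero (L : E →L[ℝ] E) : expFlow L 0 = 1 := by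
  rw [expFlow, zero_smul, NormedSpace.exp_zero]

variable [CompleteSpace E]

theorem hasDerivAt_expFlow_apply (L : E →L[ℝ] E) (ℓ : E →L[ℝ] ℝ) (f : E) (t : ℝ) :
    HasDerivAt (fun t => ℓ (expFlow L t f)) (ℓ (expFlow L t (L f))) t :=
  (ℓ.comp (ContinuousLinearMap.apply ℝ E f)).hasFDerivAt.comp_hasDerivAt t
    (hasDerivAt_exp_smul_const (𝕂 := ℝ) L t)

/-- Uniformization: for large `c` the operator `L + c` preserves positivity, hence so does each term
of its exponential series for `t ≥ 0`. -/
theorem expFlow_eq_smul_exp (L : E →L[ℝ] E) (c t : ℝ) :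
    expFlow L t = Real.exp (-(t * c)) • NormedSpace.exp (t • (L + c • (1 : E →L[ℝ] E))) := by
  have h1 : t • L = algebraMap ℝ (E →L[ℝ] E) (-(t * c)) + t • (L + c • (1 : E →L[ℝ] E)) := by
    rw [Algebra.algebraMap_eq_smul_one, smul_add, smul_smul, neg_smul]
    abel
  let _ : NormedAlgebra ℚ (E →L[ℝ] E) := NormedAlgebra.restrictScalars ℚ ℝ (E →L[ℝ] E)
  rw [expFlow, h1, NormedSpace.exp_add_of_commute (Algebra.commutes _ _),
    ← NormedSpace.algebraMap_exp_comm, Real.exp_eq_exp_ℝ, ← Algebra.smul_def]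

theorem expFlow_apply_nonneg (L : E →L[ℝ] E) (c t : ℝ) (ℓ : E →L[ℝ] ℝ) (f : E)
    (h : ∀ k, 0 ≤ ℓ (((t • (L + c • (1 : E →L[ℝ] E))) ^ k) f)) : 0 ≤ ℓ (expFlow L t f) := by
  have h1 := (NormedSpace.exp_series_hasSum_exp' (𝕂 := ℝ)
    (t • (L + c • (1 : E →L[ℝ] E)))).mapL (ℓ.comp (ContinuousLinearMap.apply ℝ E f))
  have h2 : 0 ≤ ℓ (NormedSpace.exp (t • (L + c • (1 : E →L[ℝ] E))) f) := by
    refine h1.nonneg fun k => ?_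
    rw [map_smul]
    exact mul_nonneg (by positivity) (h k)
  rw [expFlow_eq_smul_exp L c]
  refine (mul_nonneg (Real.exp_pos (-(t * c))).le h2).trans_eq ?_
  rw [← smul_eq_mul, ← map_smul]
  rfl

end ExpFlow

theorem expFlow_boundedContinuousFunction_nonneg {X : Type*} [TopologicalSpace X]
    {L : (X →ᵇ ℝ) →L[ℝ] (X →ᵇ ℝ)} {c : ℝ}
    (hL : ∀ f : X →ᵇ ℝ, (∀ x, 0 ≤ f x) → ∀ x, 0 ≤ L f x + c * f x) {t : ℝ} (ht : 0 ≤ t)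
    {f : X →ᵇ ℝ} (hf : ∀ x, 0 ≤ f x) (x : X) : 0 ≤ expFlow L t f x := by
  refine expFlow_apply_nonneg L c t (BoundedContinuousFunction.evalCLM ℝ x) f fun k => ?_
  suffices h : ∀ y, 0 ≤ ((t • (L + c • (1 : (X →ᵇ ℝ) →L[ℝ] (X →ᵇ ℝ)))) ^ k) f y from h x
  induction k with
  | zero => simpa using hf
  | succ k ih =>
    intro y
    rw [pow_succ']
    exact mul_nonneg ht (hL _ ih y)

section GossipMean

variable {M n : ℕ} {R : Matrix (Fin M) (Fin M) ℝ} {lams lam : ℝ}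

theorem gossipGenerator_apply (f : GossipState M n →ᵇ ℝ) (x : GossipState M n) :
    gossipGenerator n R lams lam f x = gossipGeneratorFun R lams lam f x := rfl

/-- The mean of an observable at time `t` when the network starts from `x`. -/
noncomputable def gossipMean (R : Matrix (Fin M) (Fin M) ℝ) (lams lam : ℝ)
    (x : GossipState M n) (t : ℝ) : (GossipState M n →ᵇ ℝ) →L[ℝ] ℝ :=
  (BoundedContinuousFunction.evalCLM ℝ x).comp
    (expFlow (gossipGenerator n R lams lam) t)

theorem gossipSemigroup_apply (t : ℝ≥0) (f : GossipState M n →ᵇ ℝ) (x : GossipState M n) :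
    gossipSemigroup n R lams lam t f x = gossipMean R lams lam x t f := rfl

theorem gossipMean_zero (x : GossipState M n) (f : GossipState M n →ᵇ ℝ) :
    gossipMean R lams lam x 0 f = f x := by
  simp [gossipMean, expFlow_zero]

theorem hasDerivAt_gossipMean (x : GossipState M n) (f : GossipState M n →ᵇ ℝ) (t : ℝ) :
    HasDerivAt (fun t => gossipMean R lams lam x t f)
      (gossipMean R lams lam x t (gossipGenerator n R lams lam f)) t :=
  hasDerivAt_expFlow_apply (gossipGenerator n R lams lam)
    (BoundedContinuousFunction.evalCLM ℝ x) f t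

theorem gossipMean_const (x : GossipState M n) (t c : ℝ) :
    gossipMean R lams lam x t (BoundedContinuousFunction.const _ c) = c := by
  have h0 : gossipGenerator n R lams lam (BoundedContinuousFunction.const _ c) = 0 := by
    ext y
    simp [gossipGenerator_apply, gossipGeneratorFun]
  have hd : ∀ t, HasDerivAt
      (fun t => gossipMean R lams lam x t (BoundedContinuousFunction.const _ c)) 0 t :=
    fun t => (hasDerivAt_gossipMean x _ t).congr_deriv (by rw [h0, map_zero])
  rw [is_const_of_deriv_eq_zero (fun t => (hd t).differentiableAt) (fun t => (hd t).deriv) t 0,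
    gossipMean_zero, BoundedContinuousFunction.const_apply]

/-- For `n = 1` the denominator is `0` and the quotient is `0` by convention. -/
theorem gossipRate_nonneg (hlam : 0 < lam) (i : Fin n) : 0 ≤ lam / ((n : ℝ) - 1) := by
  have : (1 : ℝ) ≤ n := by exact_mod_cast i.pos
  exact div_nonneg hlam.le (by linarith)

/-- All rates are nonnegative, so a bound on increments bounds the drift; `d j` is the extra
decrease gained by pushing to `j`. `gossipRateBound` overestimates the total rate, which is harmless
since `0 ≤ D`. -/
theorem gossipGeneratorFun_le (hR : IsIrreducibleGenerator R) (hlams : 0 < lams) (hlam : 0 < lam)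
    {f : GossipState M n → ℝ} {x : GossipState M n} {D : ℝ} (hD : 0 ≤ D) (d : Fin n → ℝ)
    (hjump : ∀ m, f (x.jump m) - f x ≤ D) (hpush : ∀ j, f (x.push j) - f x ≤ D - d j)
    (hgossip : ∀ i j, f (x.gossip i j) - f x ≤ D) :
    gossipGeneratorFun R lams lam f x
      ≤ gossipRateBound n R lams lam * D - ∑ j, lams / (n : ℝ) * d j := by
  have key : ∀ {c v : ℝ}, 0 ≤ c → v ≤ D → c * v ≤ |c| * 2 * D := by
    intro c v hc hv
    rw [abs_of_nonneg hc]
    nlinarith [mul_le_mul_of_nonneg_left hv hc, mul_nonneg hc hD]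
  have nn : ∀ c : ℝ, 0 ≤ |c| * 2 * D := fun c => by positivity
  have hj : ∑ m ∈ Finset.univ.erase x.source, R x.source m * (f (x.jump m) - f x)
      ≤ (∑ i, ∑ m, |R i m| * 2) * D := by
    refine (Finset.sum_le_sum fun m hm => key
      (hR.offDiag_nonneg _ _ (Finset.ne_of_mem_erase hm).symm) (hjump m)).trans ?_
    rw [Finset.sum_mul]
    refine le_trans ?_ (Finset.single_le_sum (f := fun i => (∑ m, |R i m| * 2) * D)
      (fun i _ => by positivity) (Finset.mem_univ x.source))
    rw [Finset.sum_mul]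
    exact Finset.sum_le_sum_of_subset_of_nonneg (Finset.erase_subset _ _) fun m _ _ => nn _
  have hp : ∑ j : Fin n, lams / (n : ℝ) * (f (x.push j) - f x)
      ≤ (∑ _j : Fin n, |lams / (n : ℝ)| * 2) * D - ∑ j, lams / (n : ℝ) * d j := by
    rw [Finset.sum_mul, ← Finset.sum_sub_distrib]
    refine Finset.sum_le_sum fun j _ => ?_
    have hc : 0 ≤ lams / (n : ℝ) := by positivity
    have := key hc (v := f (x.push j) - f x + d j) (by linarith [hpush j])
    linarith
  have hg : ∑ i : Fin n, ∑ j ∈ Finset.univ.erase i,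
      lam / ((n : ℝ) - 1) * (f (x.gossip i j) - f x)
      ≤ (∑ _i : Fin n, ∑ _j : Fin n, |lam / ((n : ℝ) - 1)| * 2) * D := by
    rw [Finset.sum_mul]
    refine Finset.sum_le_sum fun i _ => ?_
    refine (Finset.sum_le_sum fun j _ => key (gossipRate_nonneg hlam i) (hgossip i j)).trans ?_
    rw [Finset.sum_mul]
    exact Finset.sum_le_sum_of_subset_of_nonneg (Finset.erase_subset _ _) fun m _ _ => nn _
  unfold gossipGeneratorFun gossipRateBound
  rw [add_mul, add_mul]
  linarith

theorem gossipMean_nonneg (hR : IsIrreducibleGenerator R) (hlams : 0 < lams) (hlam : 0 < lam)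
    (x : GossipState M n) {t : ℝ} (ht : 0 ≤ t) {f : GossipState M n →ᵇ ℝ} (hf : ∀ y, 0 ≤ f y) :
    0 ≤ gossipMean R lams lam x t f := by
  refine expFlow_boundedContinuousFunction_nonneg (c := gossipRateBound n R lams lam) (fun g hg y => ?_) ht hf x
  -- For `-g` every increment from `y` is at most `g y`, which yields `0 ≤ L g + c g` at `y`.
  have h := gossipGeneratorFun_le hR hlams hlam (f := (-g : GossipState M n →ᵇ ℝ)) (x := y)
    (hg y) 0
    (fun m => by simpa using hg (y.jump m)) (fun j => by simpa using hg (y.push j))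
    (fun i j => by simpa using hg (y.gossip i j))
  rw [← gossipGenerator_apply, map_neg] at h
  simp only [BoundedContinuousFunction.coe_neg, Pi.neg_apply, Pi.zero_apply, mul_zero,
    Finset.sum_const_zero, sub_zero] at h
  linarith

theorem gossipMean_mono (hR : IsIrreducibleGenerator R) (hlams : 0 < lams) (hlam : 0 < lam)
    (x : GossipState M n) {t : ℝ} (ht : 0 ≤ t) {f g : GossipState M n →ᵇ ℝ}
    (hfg : ∀ y, f y ≤ g y) : gossipMean R lams lam x t f ≤ gossipMean R lams lam x t g := by
  have := gossipMean_nonneg hR hlams hlam x ht (f := g - f) (fun y => by simpa using hfg y)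
  rw [map_sub] at this
  linarith

end GossipMean

/-! ### Consistent states -/

namespace GossipState

variable {M n : ℕ}

/-- Packets of the same version have the same content, and packets of version age `0` hold the
current state of the source. -/
def IsConsistent (x : GossipState M n) : Prop :=
  (∀ i j, x.age i = x.age j → x.content i = x.content j) ∧
    ∀ i, x.age i = 0 → x.content i = x.source

theorem IsConsistent.jump {x : GossipState M n} (hx : x.IsConsistent) (m : Fin M) :
    (x.jump m).IsConsistent :=
  ⟨fun i j h => hx.1 i j (by simpa [GossipState.jump] using h),
    fun i h => by simp [GossipState.jump] at h⟩

theorem IsConsistent.push {x : GossipState M n} (hx : x.IsConsistent) (k : Fin n) :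
    (x.push k).IsConsistent := by
  obtain ⟨h1, h2⟩ := hx
  simp only [IsConsistent, GossipState.push, Function.update_apply]
  grind

theorem IsConsistent.gossip {x : GossipState M n} (hx : x.IsConsistent) (a b : Fin n) :
    (x.gossip a b).IsConsistent := by
  obtain ⟨h1, h2⟩ := hx
  simp only [IsConsistent, GossipState.gossip, Function.update_apply]
  grind

/-- The number of nodes that do not hold the current version of the source. -/
def staleCount (x : GossipState M n) : ℕ :=
  (Finset.univ.filter fun l => ¬(x.age l = 0 ∧ x.content l = x.source)).card

theorem staleCount_le (x : GossipState M n) : x.staleCount ≤ n :=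
  (Finset.card_le_univ _).trans_eq (Fintype.card_fin n)

/-- Without stale nodes the state would be consistent. A push to a stale node makes it current and
leaves the others unchanged. -/
theorem exists_staleCount_push_lt {x : GossipState M n} (hx : ¬x.IsConsistent) :
    ∃ l, (x.push l).staleCount < x.staleCount := by
  obtain ⟨l, hl⟩ : ∃ l, ¬(x.age l = 0 ∧ x.content l = x.source) := by
    by_contra! h
    exact hx ⟨fun i j _ => (h i).2.trans (h j).2.symm, fun i _ => (h i).2⟩
  refine ⟨l, Finset.card_lt_card (Finset.ssubset_iff_subset_ne.2 ⟨fun k hk => ?_, fun h => ?_⟩)⟩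
  · simp only [push, Finset.mem_filter, Finset.mem_univ, true_and, Function.update_apply] at hk ⊢
    grind
  · have hl' : l ∈ Finset.univ.filter fun l => ¬(x.age l = 0 ∧ x.content l = x.source) := by
      simpa using hl
    rw [← h] at hl'
    simp [push] at hl'

end GossipState

section Lyapunov

variable {M n : ℕ} {R : Matrix (Fin M) (Fin M) ℝ} {lams lam : ℝ}

open Classical in
-- The function is `0` on consistent states and `2 - θ ^ staleCount` elsewhere. With `w` the stale
-- count, any transition raises it by at most `θ ^ w`, while some push of rate `p` changes it by at
-- most `θ ^ w - θ ^ (w - 1)`. For small `θ` this gain dominates.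
theorem exists_lyapunov (hR : IsIrreducibleGenerator R) (hlams : 0 < lams) (hlam : 0 < lam)
    (hn : 0 < n) : ∃ u : GossipState M n →ᵇ ℝ, ∃ c, 0 < c ∧ (∀ x, 0 ≤ u x) ∧
      (∀ x, ¬x.IsConsistent → 1 ≤ u x) ∧ ∀ x, gossipGenerator n R lams lam u x ≤ -c * u x := by
  set r := gossipRateBound n R lams lam with hr
  have hr0 : 0 ≤ r := gossipRateBound_nonneg n R lams lam
  set p := lams / (n : ℝ) with hp
  have hp0 : 0 < p := by positivity
  -- Chosen so that `r θ ≤ p / 2`: the possible increases cost at most half of the gain.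
  set θ := p / (2 * (r + p)) with hθ
  have hθ0 : 0 < θ := by positivity
  have hθ1 : θ ≤ 1 := by
    rw [hθ, div_le_one (by positivity)]
    linarith
  have hrθ : r * θ ≤ p / 2 := by
    rw [hθ, mul_div_assoc', div_le_iff₀ (by positivity)]
    nlinarith
  let v : GossipState M n → ℝ := fun x => if x.IsConsistent then 0 else 2 - θ ^ x.staleCount
  have hpow0 : ∀ k : ℕ, 0 < θ ^ k := fun k => pow_pos hθ0 k
  have hpow1 : ∀ k : ℕ, θ ^ k ≤ 1 := fun k => pow_le_one₀ hθ0.le hθ1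
  have hv0 : ∀ x, 0 ≤ v x := by
    intro x
    simp only [v]
    split_ifs
    · exact le_rfl
    · linarith [hpow1 x.staleCount]
  have hvle : ∀ x, v x ≤ 2 - θ ^ x.staleCount := by
    intro x
    simp only [v]
    split_ifs
    · linarith [hpow1 x.staleCount]
    · exact le_rfl
  have hv2 : ∀ x, v x ≤ 2 := fun x => by linarith [hvle x, hpow0 x.staleCount]
  have hvC : ∀ x, x.IsConsistent → v x = 0 := fun x hx => if_pos hx
  have hvN : ∀ x, ¬x.IsConsistent → v x = 2 - θ ^ x.staleCount := fun x hx => if_neg hx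
  refine ⟨BoundedContinuousFunction.ofNormedAddCommGroupDiscrete v 2
    (fun x => by rw [Real.norm_of_nonneg (hv0 x)]; exact hv2 x), p / 4 * θ ^ n,
    mul_pos (by positivity) (hpow0 n), hv0, fun x hx => ?_, fun x => ?_⟩
  · rw [BoundedContinuousFunction.coe_ofNormedAddCommGroupDiscrete, hvN x hx]
    linarith [hpow1 x.staleCount]
  rw [gossipGenerator_apply, BoundedContinuousFunction.coe_ofNormedAddCommGroupDiscrete]
  by_cases hx : x.IsConsistent
  · have := gossipGeneratorFun_le hR hlams hlam (f := v) (x := x) le_rfl 0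
      (fun m => by simp [hvC _ hx, hvC _ (hx.jump m)])
      (fun j => by simp [hvC _ hx, hvC _ (hx.push j)])
      (fun i j => by simp [hvC _ hx, hvC _ (hx.gossip i j)])
    simpa [hvC _ hx] using this
  · obtain ⟨l, hl⟩ := GossipState.exists_staleCount_push_lt hx
    have hvx := hvN x hx
    set w := x.staleCount with hw
    have hle : ∀ y, v y - v x ≤ θ ^ w := fun y => by linarith [hv2 y]
    have := gossipGeneratorFun_le hR hlams hlam (f := v) (x := x) (hpow0 w).le
      (Pi.single l (θ ^ (w - 1))) (fun m => hle _) (fun j => ?_) (fun i j => hle _)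
    · rw [← Finset.mul_sum, Finset.sum_pi_single'] at this
      simp only [Finset.mem_univ, if_true] at this
      rw [← hr, ← hp] at this
      have hw1 : θ ^ w = θ * θ ^ (w - 1) := by
        rw [← pow_succ', Nat.sub_add_cancel (by omega)]
      have hwn : θ ^ n ≤ θ ^ (w - 1) :=
        pow_le_pow_of_le_one hθ0.le hθ1 ((Nat.sub_le _ _).trans x.staleCount_le)
      have h1 : r * θ ^ w ≤ p / 2 * θ ^ (w - 1) := by
        rw [hw1, ← mul_assoc]
        exact mul_le_mul_of_nonneg_right hrθ (hpow0 _).le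
      have h2 : p / 4 * θ ^ n * v x ≤ p / 4 * θ ^ n * 2 :=
        mul_le_mul_of_nonneg_left (hv2 x) (mul_pos (by positivity) (hpow0 n)).le
      have h3 : p * θ ^ n ≤ p * θ ^ (w - 1) := mul_le_mul_of_nonneg_left hwn hp0.le
      linarith
    · by_cases hj : j = l
      · subst hj
        rw [Pi.single_eq_same]
        have h1 := hvle (x.push j)
        have h2 : θ ^ (w - 1) ≤ θ ^ (x.push j).staleCount :=
          pow_le_pow_of_le_one hθ0.le hθ1 (by omega)
        linarith
      · rw [Pi.single_eq_of_ne hj, sub_zero]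
        exact hle _

theorem tendsto_gossipMean_zero (hR : IsIrreducibleGenerator R) (hlams : 0 < lams)
    (hlam : 0 < lam) (hn : 0 < n) (x : GossipState M n) {f : GossipState M n →ᵇ ℝ}
    (hf : ∀ y, y.IsConsistent → f y = 0) :
    Tendsto (fun t => gossipMean R lams lam x t f) atTop (𝓝 0) := by
  obtain ⟨u, c, hc, hu0, hu1, hLu⟩ := exists_lyapunov (M := M) hR hlams hlam hn
  have hu : Tendsto (fun t => gossipMean R lams lam x t u) atTop (𝓝 0) :=
    tendsto_zero_of_deriv_le hc (hasDerivAt_gossipMean x u)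
      (fun t ht => gossipMean_nonneg hR hlams hlam x ht hu0)
      (fun t ht => by
        rw [← smul_eq_mul (-c), ← map_smul]
        exact gossipMean_mono hR hlams hlam x ht hLu)
  -- The Lyapunov function is at least `1` wherever `f` may be nonzero.
  have hbound : ∀ y, |f y| ≤ ‖f‖ * u y := by
    intro y
    by_cases hy : y.IsConsistent
    · rw [hf y hy, abs_zero]
      exact mul_nonneg (norm_nonneg f) (hu0 y)
    · exact (f.norm_coe_le_norm y).trans (le_mul_of_one_le_right (norm_nonneg f) (hu1 y hy))
  have hup : Tendsto (fun t => ‖f‖ * gossipMean R lams lam x t u) atTop (𝓝 0) := by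
    simpa using hu.const_mul ‖f‖
  refine squeeze_zero_norm' ?_ hup
  filter_upwards [eventually_ge_atTop 0] with t ht
  rw [Real.norm_eq_abs, abs_le, ← smul_eq_mul ‖f‖, ← map_smul, ← map_neg]
  exact ⟨gossipMean_mono hR hlams hlam x ht fun y => (abs_le.1 (hbound y)).1,
    gossipMean_mono hR hlams hlam x ht fun y => (abs_le.1 (hbound y)).2⟩

end Lyapunov

/-! ### Observables of the network -/

namespace GossipState

variable {M n : ℕ}

open Classical in
/-- The indicator function of a property of configurations. -/
noncomputable def indicator (p : GossipState M n → Prop) : GossipState M n →ᵇ ℝ :=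
  BoundedContinuousFunction.ofNormedAddCommGroupDiscrete (fun x => if p x then 1 else 0) 1
    (fun x => by split_ifs <;> simp)

theorem indicator_apply (p : GossipState M n → Prop) (x : GossipState M n) [Decidable (p x)] :
    indicator p x = if p x then 1 else 0 := by
  simp only [indicator, BoundedContinuousFunction.coe_ofNormedAddCommGroupDiscrete]
  congr

open Classical in
theorem indicator_congr {p p' : GossipState M n → Prop} {x y : GossipState M n}
    (h : p x ↔ p' y) : indicator p x = indicator p' y := by
  rw [indicator_apply, indicator_apply]
  exact if_congr h rfl rfl

/-- The content of a freshest packet stored in `B` is `q`. -/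
def FreshestHolds (B : Finset (Fin n)) (q : Fin M) (x : GossipState M n) : Prop :=
  ∃ i ∈ B, x.content i = q ∧ ∀ l ∈ B, x.age i ≤ x.age l

theorem freshestHolds_singleton (j : Fin n) (q : Fin M) (x : GossipState M n) :
    x.FreshestHolds {j} q ↔ x.content j = q := by
  simp [FreshestHolds]

theorem freshestHolds_jump (B : Finset (Fin n)) (q : Fin M) (x : GossipState M n) (m : Fin M) :
    (x.jump m).FreshestHolds B q ↔ x.FreshestHolds B q := by
  simp [FreshestHolds, jump]

theorem freshestHolds_push_of_notMem {B : Finset (Fin n)} {j : Fin n} (hj : j ∉ B) (q : Fin M)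
    (x : GossipState M n) : (x.push j).FreshestHolds B q ↔ x.FreshestHolds B q := by
  simp only [FreshestHolds, GossipState.push, Function.update_apply]
  grind

/-- After the push the minimal age in `B` is `0`, and by consistency every packet of age `0` holds
the source state. -/
theorem IsConsistent.freshestHolds_push {x : GossipState M n} (hx : x.IsConsistent)
    {B : Finset (Fin n)} {j : Fin n} (hj : j ∈ B) (q : Fin M) :
    (x.push j).FreshestHolds B q ↔ x.source = q := by
  obtain ⟨h1, h2⟩ := hx
  simp only [FreshestHolds, GossipState.push, Function.update_apply]
  constructor
  · rintro ⟨i, hi, hq, hle⟩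
    have := hle j hj
    grind
  · intro h
    exact ⟨j, hj, by simpa using h, by simp⟩

theorem freshestHolds_gossip_of_notMem {B : Finset (Fin n)} {j : Fin n} (hj : j ∉ B)
    (i : Fin n) (q : Fin M) (x : GossipState M n) :
    (x.gossip i j).FreshestHolds B q ↔ x.FreshestHolds B q := by
  simp only [FreshestHolds, GossipState.gossip, Function.update_apply]
  grind

/-- The packet lost at `j` is always no fresher than the one kept, so the minimum over `B`
afterwards is the minimum over `insert i B` before. Consistency settles ties between `i` and `j`. -/
theorem IsConsistent.freshestHolds_gossip {x : GossipState M n} (hx : x.IsConsistent)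
    {B : Finset (Fin n)} {j : Fin n} (hj : j ∈ B) (i : Fin n) (q : Fin M) :
    (x.gossip i j).FreshestHolds B q ↔ x.FreshestHolds (insert i B) q := by
  obtain ⟨h1, -⟩ := hx
  simp only [FreshestHolds, GossipState.gossip, Function.update_apply, Finset.mem_insert]
  constructor
  · rintro ⟨a, ha, hq, hle⟩
    have hj' := hle j hj
    by_cases haj : a = j
    · by_cases hlt : x.age i < x.age j
      · refine ⟨i, Or.inl rfl, by grind, ?_⟩
        rintro l (rfl | hl)
        · exact le_rfl
        · have := hle l hl
          grind
      · refine ⟨j, Or.inr hj, by grind, ?_⟩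
        rintro l (rfl | hl)
        · exact not_lt.1 hlt
        · have := hle l hl
          grind
    · refine ⟨a, Or.inr ha, by grind, ?_⟩
      rintro l (rfl | hl)
      · grind
      · have := hle l hl
        grind
  · rintro ⟨a, ha, hq, hle⟩
    have hi := hle i (Or.inl rfl)
    have hj' := hle j (Or.inr hj)
    by_cases haB : a ∈ B ∧ a ≠ j
    · refine ⟨a, haB.1, by grind, fun l hl => ?_⟩
      have := hle l (Or.inr hl)
      grind
    · refine ⟨j, hj, ?_, fun l hl => ?_⟩
      · have := h1 i j
        grind
      · have := hle l (Or.inr hl)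
        grind

theorem numHolding_eq_sum (A : Finset (Fin n)) (q : Fin M) (x : GossipState M n) :
    (numHolding A q x : ℝ) = (∑ j ∈ A, indicator fun x => x.content j = q) x := by
  simp [numHolding, indicator_apply, BoundedContinuousFunction.coe_sum, Finset.sum_apply]

end GossipState

section Duality

open GossipState

variable {M n : ℕ} {R : Matrix (Fin M) (Fin M) ℝ} {lams lam : ℝ}

theorem gossipGenerator_indicator_source (hR : IsIrreducibleGenerator R) (m : Fin M) :
    gossipGenerator n R lams lam (indicator fun x => x.source = m)
      = ∑ i, R i m • indicator fun x => x.source = i := by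
  ext x
  rw [gossipGenerator_apply]
  have h1 : ∑ k ∈ Finset.univ.erase x.source, R x.source k *
      ((if k = m then (1 : ℝ) else 0) - if x.source = m then 1 else 0) = R x.source m := by
    -- The diagonal term has zero increment, so the sum may run over all states; zero row sums then
    -- remove the subtracted part.
    rw [Finset.sum_erase _ (by simp)]
    simp [mul_sub, Finset.sum_sub_distrib, hR.row_sum]
  simpa [gossipGeneratorFun, indicator_apply, GossipState.jump, GossipState.push,
    GossipState.gossip, BoundedContinuousFunction.coe_sum, Finset.sum_apply] using h1

/-- The action of the generator on the content of the freshest packet of `B`. -/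
noncomputable def freshestDrift (lams lam : ℝ) (B : Finset (Fin n)) (q : Fin M) :
    GossipState M n →ᵇ ℝ :=
  (∑ _j ∈ B, (lams / (n : ℝ)) •
      ((indicator fun x => x.source = q) - indicator (FreshestHolds B q)))
    + ∑ i, ∑ _j ∈ B.erase i, (lam / ((n : ℝ) - 1)) •
      (indicator (FreshestHolds (insert i B) q) - indicator (FreshestHolds B q))

theorem gossipGenerator_indicator_freshestHolds {x : GossipState M n} (hx : x.IsConsistent)
    (B : Finset (Fin n)) (q : Fin M) :
    gossipGenerator n R lams lam (indicator (FreshestHolds B q)) x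
      = freshestDrift lams lam B q x := by
  rw [gossipGenerator_apply, gossipGeneratorFun, freshestDrift]
  simp only [BoundedContinuousFunction.coe_add, BoundedContinuousFunction.coe_sum,
    BoundedContinuousFunction.coe_smul, BoundedContinuousFunction.coe_sub, Pi.add_apply,
    Pi.sub_apply, Finset.sum_apply, smul_eq_mul]
  rw [Finset.sum_eq_zero fun m _ => by
    rw [indicator_congr (freshestHolds_jump B q x m), sub_self, mul_zero], zero_add]
  congr 1
  · rw [← Finset.sum_subset (Finset.subset_univ B) fun j _ hj => by
      rw [indicator_congr (freshestHolds_push_of_notMem hj q x), sub_self, mul_zero]]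
    exact Finset.sum_congr rfl fun j hj => by
      rw [indicator_congr (p' := fun x => x.source = q) (hx.freshestHolds_push hj q)]
  · refine Finset.sum_congr rfl fun i _ => ?_
    rw [← Finset.sum_subset (Finset.erase_subset_erase i (Finset.subset_univ B))
      fun j hj hjB => by
        rw [indicator_congr (freshestHolds_gossip_of_notMem
          (fun h => hjB (Finset.mem_erase.2 ⟨Finset.ne_of_mem_erase hj, h⟩)) i q x),
          sub_self, mul_zero]]
    exact Finset.sum_congr rfl fun j hj => by
      rw [indicator_congr (hx.freshestHolds_gossip (Finset.mem_of_mem_erase hj) i q)]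

end Duality

/-! ### Limits of the means -/

section Limits

open GossipState

variable {M n : ℕ} {R : Matrix (Fin M) (Fin M) ℝ} {π : Fin M → ℝ} {lams lam : ℝ}

theorem tendsto_gossipMean_source (hR : IsIrreducibleGenerator R)
    (hπ : IsStationaryDistribution R π) (x : GossipState M n) (q : Fin M) :
    Tendsto (fun t => gossipMean R lams lam x t (indicator fun x => x.source = q)) atTop
      (𝓝 (π q)) := by
  refine tendsto_stationary_of_hasDerivAt hR hπ
    (b := fun t i => gossipMean R lams lam x t (indicator fun x => x.source = i))
    (fun j t => (hasDerivAt_gossipMean x _ t).congr_deriv ?_) ?_ q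
  · rw [gossipGenerator_indicator_source hR, map_sum]
    exact Finset.sum_congr rfl fun i _ => by rw [map_smul, smul_eq_mul, mul_comm]
  · simp [gossipMean_zero, indicator_apply]

theorem tendsto_gossipMean_freshestHolds (hR : IsIrreducibleGenerator R)
    (hπ : IsStationaryDistribution R π) (hlams : 0 < lams) (hlam : 0 < lam)
    (x : GossipState M n) (q : Fin M) (B : Finset (Fin n)) (hB : B.Nonempty) :
    Tendsto (fun t => gossipMean R lams lam x t (indicator (FreshestHolds B q))) atTop
      (𝓝 (π q)) := by
  -- Induction along strict supersets; for the full set only the source term drives the equation.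
  induction B using WellFoundedGT.induction with
  | ind B ih =>
  set h : Finset (Fin n) → GossipState M n →ᵇ ℝ := fun B => indicator (FreshestHolds B q) with hh
  set g : GossipState M n →ᵇ ℝ := indicator fun x => x.source = q with hg
  set φ := gossipMean R lams lam x with hφ
  set p := lams / (n : ℝ) with hp
  set r := lam / ((n : ℝ) - 1) with hr
  obtain ⟨j₀, hj₀⟩ := hB
  have hn : 0 < n := j₀.pos
  have hp0 : 0 < p := by positivity
  have hr0 : 0 ≤ r := gossipRate_nonneg hlam j₀
  -- For `i ∈ B` insertion changes nothing and the gossip term cancels. Giving it weight `0` means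
  -- that the induction hypothesis is used only for strictly larger sets.
  set κ : ℝ := ∑ _j ∈ B, p + ∑ i, ∑ _j ∈ B.erase i, if i ∈ B then 0 else r with hκ
  -- The error of the duality relation, zero on consistent states.
  set e : GossipState M n →ᵇ ℝ := gossipGenerator n R lams lam (h B) - freshestDrift lams lam B q
    with he
  have hκ0 : 0 < κ := by
    refine add_pos_of_pos_of_nonneg (Finset.sum_pos (fun _ _ => hp0) ⟨j₀, hj₀⟩)
      (Finset.sum_nonneg fun i _ => Finset.sum_nonneg fun j _ => ?_)
    split_ifs
    exacts [le_rfl, hr0]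
  refine tendsto_of_hasDerivAt_relaxation
    (F := fun t => ∑ _j ∈ B, p * φ t g +
      ∑ i, ∑ _j ∈ B.erase i, (if i ∈ B then 0 else r) * φ t (h (insert i B)) + φ t e) hκ0
    (fun t => (hasDerivAt_gossipMean x (h B) t).congr_deriv ?_) ?_
  · rw [← sub_add_cancel (gossipGenerator n R lams lam (h B)) (freshestDrift lams lam B q), ← he,
      map_add, freshestDrift]
    simp only [map_add, map_sum, map_smul, map_sub, smul_eq_mul]
    have hterm : ∀ i, ∀ j ∈ B.erase i, r * (φ t (h (insert i B)) - φ t (h B))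
        = (if i ∈ B then 0 else r) * φ t (h (insert i B))
          - (if i ∈ B then 0 else r) * φ t (h B) := by
      intro i j _
      split_ifs with hi
      · rw [Finset.insert_eq_of_mem hi]
        ring
      · ring
    have hsum := Finset.sum_congr rfl fun i (_ : i ∈ Finset.univ) =>
      Finset.sum_congr rfl (hterm i)
    simp only [← hφ, ← hp, ← hr, ← hg]
    change φ t e + (_ + ∑ i, ∑ _j ∈ B.erase i, r * (φ t (h (insert i B)) - φ t (h B))) = _
    rw [hsum, hκ, add_mul]
    simp only [Finset.sum_mul, mul_sub, Finset.sum_sub_distrib]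
    ring
  · have hlim : Tendsto (fun t => φ t e) atTop (𝓝 0) :=
      tendsto_gossipMean_zero hR hlams hlam hn x fun y hy => by
        rw [he, BoundedContinuousFunction.coe_sub, Pi.sub_apply, sub_eq_zero]
        exact gossipGenerator_indicator_freshestHolds hy B q
    have hlim1 : Tendsto (fun t => ∑ _j ∈ B, p * φ t g) atTop (𝓝 (∑ _j ∈ B, p * π q)) :=
      tendsto_finsetSum B fun _ _ => (tendsto_gossipMean_source hR hπ x q).const_mul p
    have hlim2 : Tendsto (fun t => ∑ i, ∑ _j ∈ B.erase i,
        (if i ∈ B then 0 else r) * φ t (h (insert i B))) atTop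
        (𝓝 (∑ i, ∑ _j ∈ B.erase i, (if i ∈ B then 0 else r) * π q)) := by
      refine tendsto_finsetSum _ fun i _ => tendsto_finsetSum _ fun _ _ => ?_
      by_cases hi : i ∈ B
      · simp [hi]
      · exact (ih _ (Finset.ssubset_insert hi) (Finset.insert_nonempty i B)).const_mul _
    have := (hlim1.add hlim2).add hlim
    simpa only [add_zero, hκ, add_mul, Finset.sum_mul] using this

theorem tendsto_gossipMean_numHolding (hR : IsIrreducibleGenerator R)
    (hπ : IsStationaryDistribution R π) (hlams : 0 < lams) (hlam : 0 < lam)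
    (x : GossipState M n) (A : Finset (Fin n)) (q : Fin M) :
    Tendsto (fun t => gossipMean R lams lam x t
      (∑ j ∈ A, indicator fun x => x.content j = q)) atTop (𝓝 (A.card * π q)) := by
  simp only [map_sum]
  rw [← nsmul_eq_mul, ← Finset.sum_const]
  refine tendsto_finsetSum A fun j _ => ?_
  have h : (indicator fun x : GossipState M n => x.content j = q)
      = indicator (FreshestHolds {j} q) := by
    ext x
    exact indicator_congr (freshestHolds_singleton j q x).symm
  rw [h]
  exact tendsto_gossipMean_freshestHolds hR hπ hlams hlam x q {j} (Finset.singleton_nonempty j)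

theorem tendsto_integral_gossipSemigroup_numHolding (hR : IsIrreducibleGenerator R)
    (hπ : IsStationaryDistribution R π) (hlams : 0 < lams) (hlam : 0 < lam)
    (A : Finset (Fin n)) (q : Fin M) {Ω : Type*} [MeasurableSpace Ω] (P : Measure Ω)
    [IsProbabilityMeasure P] {Y : Ω → GossipState M n} (hY : Measurable Y) :
    Tendsto (fun t : ℝ≥0 => ∫ ω, gossipSemigroup n R lams lam t
      (∑ j ∈ A, indicator fun x => x.content j = q) (Y ω) ∂P) atTop (𝓝 (A.card * π q)) := by
  have hlim := tendsto_integral_filter_of_dominated_convergence (μ := P)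
    (l := (atTop : Filter ℝ≥0))
    (F := fun t ω => gossipSemigroup n R lams lam t
      (∑ j ∈ A, indicator fun x => x.content j = q) (Y ω))
    (f := fun _ => (A.card : ℝ) * π q) (fun _ => (A.card : ℝ))
    (Eventually.of_forall fun t => (measurable_from_top.comp hY).aestronglyMeasurable)
    (Eventually.of_forall fun t => Eventually.of_forall fun ω => ?_) (integrable_const _)
    (Eventually.of_forall fun ω => (tendsto_gossipMean_numHolding hR hπ hlams hlam (Y ω) A q).comp
      (NNReal.tendsto_coe_atTop.2 tendsto_id))
  · simpa using hlim
  · have hf : ∀ y, 0 ≤ (∑ j ∈ A, indicator fun x : GossipState M n => x.content j = q) y ∧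
        (∑ j ∈ A, indicator fun x : GossipState M n => x.content j = q) y
          ≤ BoundedContinuousFunction.const _ (A.card : ℝ) y := by
      intro y
      rw [← numHolding_eq_sum]
      exact ⟨Nat.cast_nonneg _, Nat.cast_le.2 (Finset.card_filter_le _ _)⟩
    rw [gossipSemigroup_apply, Real.norm_of_nonneg
      (gossipMean_nonneg hR hlams hlam _ t.coe_nonneg fun y => (hf y).1)]
    refine (gossipMean_mono hR hlams hlam _ t.coe_nonneg fun y => (hf y).2).trans_eq
      (gossipMean_const _ _ _)

end Limits

theorem mainTheorem3 {M n : ℕ} (R : Matrix (Fin M) (Fin M) ℝ) (hR : IsIrreducibleGenerator R)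
    (π : Fin M → ℝ) (hπ : IsStationaryDistribution R π)
    (lams lam : ℝ) (hlams : 0 < lams) (hlam : 0 < lam)
    (k : ℕ) (A : Finset (Fin n)) (hA : A.card = k) (q : Fin M) :
    (∀ {Ω : Type*} [MeasurableSpace Ω] (P : Measure Ω) [IsProbabilityMeasure P]
        (Y : ℝ≥0 → Ω → GossipState M n), IsGossipProcess P R lams lam Y →
        Tendsto (fun t : ℝ≥0 => ∫ ω, (GossipState.numHolding A q (Y t ω) : ℝ) ∂P) atTop
          (𝓝 ((k : ℝ) * π q))) ∧
      (∀ (μ : Measure (GossipState M n)) [IsProbabilityMeasure μ],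
        IsSteadyStateLaw R lams lam μ →
        ∫ x, (GossipState.numHolding A q x : ℝ) ∂μ = (k : ℝ) * π q) := by
  subst hA
  simp only [GossipState.numHolding_eq_sum]
  refine ⟨fun {Ω} _ P _ Y hY => ?_, fun μ _ hμ => ?_⟩
  · refine (tendsto_integral_gossipSemigroup_numHolding hR hπ hlams hlam A q P
      (hY.measurable 0)).congr fun t => ?_
    have hle : (⨆ r : Set.Iic (0 : ℝ≥0), MeasurableSpace.comap (Y r) inferInstance)
        ≤ ‹MeasurableSpace Ω› := iSup_le fun r => (hY.measurable r).comap_le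
    -- The Markov property at time `0`, integrated, expresses the mean at time `t` through the law
    -- of `Y 0`.
    rw [← integral_congr_ae (hY.markov 0 t _), integral_condExp hle, zero_add]
  · exact tendsto_nhds_unique tendsto_const_nhds
      ((tendsto_integral_gossipSemigroup_numHolding hR hπ hlams hlam A q μ
        measurable_id).congr fun t => hμ t _)
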